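/- Let $\ell^2$ be the complex Hilbert space of square-summable sequences, with canonical orthonormal basis $(e_i)_{i\in\mathbb{N}}$, and let $B(\ell^2)$ be the space of bounded linear operators on $\ell^2$ with the operator norm. Identify $a\in B(\ell^2)$ with the infinite matrix $[a_{ij}]$, $a_{ij}=\langle a e_j,e_i\rangle$ (inner product linear in the first variable). The Schur product $a\ast b\in B(\ell^2)$ is the operator with matrix $[a_{ij}b_{ij}]$, and the transpose $a^t\in B(\ell^2)$ is the operator with matrix $[a_{ji}]$. A linear map $T:B(\ell^2)\to B(\ell^2)$ is called contractive if $\|T(a)\|\le\|a\|$ for all $a\in B(\ell^2)$, and Schur multiplicative if $T(a)\ast T(b)=T(a\ast b)$ for all $a,b\in B(\ell^2)$. A permutation unitary is a unitary $u\in B(\ell^2)$ for which there is a permutation $\pi$ of $\mathbb{N}$ with $u e_j=e_{\pi(j)}$ for all $j\in\mathbb{N}$. Theorem. Let $T:B(\ell^2)\to B(\ell^2)$ be a linear bijection. Then $T$ is contractive and Schur multiplicative if and only if there are permutation unitaries $u,v\in B(\ell^2)$ such that either $T(a)=u\,a\,v$ for all $a\in B(\ell^2)$, or $T(a)=u\,a^t\,v$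 for all $a\in B(\ell^2)$. -/

import Mathlib

open scoped ComplexConjugate

noncomputable section

/-- The complex Hilbert space `ℓ²` of square-summable sequences indexed by `ℕ`. -/
abbrev Ell2 : Type := lp (fun _ : ℕ => ℂ) 2

/-- `B(ℓ²)`, the bounded linear operators on `ℓ²`, with the operator norm. -/
abbrev BEll2 : Type := Ell2 →L[ℂ] Ell2

namespace Ell2

/-- The canonical orthonormal basis vector `e_j` of `ℓ²`. -/
def e (j : ℕ) : Ell2 := lp.single 2 j (1 : ℂ)

theorem norm_e (j : ℕ) : ‖e j‖ = 1 := by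
  simp [e, lp.norm_single]

theorem inner_e (i : ℕ) (x : Ell2) : inner ℂ (e i) x = x i := by
  simp [e, lp.inner_single_left]

theorem hasSum_norm_sq (x : Ell2) : HasSum (fun j => ‖x j‖ ^ 2) (‖x‖ ^ 2) := by
  have h := lp.hasSum_norm (p := 2) (by simp) x
  simpa using h

theorem norm_apply_le (x : Ell2) (j : ℕ) : ‖x j‖ ≤ ‖x‖ :=
  lp.norm_apply_le_norm (by simp) x j

/-- A square-summable sequence as an element of `ℓ²`. -/
def ofSummable (f : ℕ → ℂ) (hf : Summable fun j => ‖f j‖ ^ 2) : Ell2 :=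
  ⟨f, memℓp_gen (by simpa using hf)⟩

theorem ofSummable_apply (f : ℕ → ℂ) (hf : Summable fun j => ‖f j‖ ^ 2) (j : ℕ) :
    ofSummable f hf j = f j := rfl

end Ell2

namespace BEll2

open Ell2

/-- The `(i, j)` matrix entry `a_{ij} = (a e_j, e_i)` of `a ∈ B(ℓ²)`, i.e. the `i`-th coordinate
of `a e_j`. -/
def entry (a : BEll2) (i j : ℕ) : ℂ := a (e j) i

theorem entry_eq_inner (a : BEll2) (i j : ℕ) : entry a i j = inner ℂ (e i) (a (e j)) :=
  (inner_e i (a (e j))).symm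

theorem norm_apply_e_le (a : BEll2) (j : ℕ) : ‖a (e j)‖ ≤ ‖a‖ := by
  simpa [norm_e] using a.le_opNorm (e j)

theorem norm_entry_le (a : BEll2) (i j : ℕ) : ‖entry a i j‖ ≤ ‖a‖ :=
  (norm_apply_le _ i).trans (norm_apply_e_le a j)

/-- The `(i, j)` entry read off from the adjoint. -/
theorem conj_adjoint_apply_e (a : BEll2) (i j : ℕ) :
    conj (ContinuousLinearMap.adjoint a (e i) j) = entry a i j := by
  rw [entry_eq_inner, ← inner_e, ContinuousLinearMap.adjoint_inner_right, inner_conj_symm]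

theorem summable_row_mul (b : BEll2) (i : ℕ) (x : Ell2) :
    Summable fun j => ‖entry b i j * x j‖ ^ 2 := by
  refine Summable.of_nonneg_of_le (fun j => by positivity) (fun j => ?_)
    ((hasSum_norm_sq x).summable.mul_left (‖b‖ ^ 2))
  rw [norm_mul, mul_pow]
  gcongr
  exact norm_entry_le b i j

/-- The sum defining one coordinate of the Schur product converges. -/
theorem hasSum_schur (a b : BEll2) (x : Ell2) (i : ℕ) :
    HasSum (fun j => entry a i j * entry b i j * x j)
      (inner ℂ (ContinuousLinearMap.adjoint a (e i)) (ofSummable _ (summable_row_mul b i x))) := by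
  have h := lp.hasSum_inner (𝕜 := ℂ) (ContinuousLinearMap.adjoint a (e i))
    (ofSummable _ (summable_row_mul b i x))
  have hfun : ∀ j, inner ℂ (ContinuousLinearMap.adjoint a (e i) j)
      (ofSummable _ (summable_row_mul b i x) j) = entry a i j * entry b i j * x j := fun j => by
    rw [RCLike.inner_apply, conj_adjoint_apply_e, ofSummable_apply]
    ring
  simpa only [hfun] using h

/-- The coordinates `(∑_j a_{ij} b_{ij} x_j)_i` of the Schur product of `a`, `b` applied to `x`. -/
def schurFun (a b : BEll2) (x : Ell2) (i : ℕ) : ℂ := ∑' j, entry a i j * entry b i j * x j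

theorem norm_schurFun_sq_le (a b : BEll2) (x : Ell2) (i : ℕ) :
    ‖schurFun a b x i‖ ^ 2 ≤ ‖a‖ ^ 2 * ∑' j, ‖entry b i j * x j‖ ^ 2 := by
  have h1 : ‖schurFun a b x i‖ ≤ ‖a‖ * ‖ofSummable _ (summable_row_mul b i x)‖ := by
    rw [schurFun, (hasSum_schur a b x i).tsum_eq]
    refine (norm_inner_le_norm _ _).trans ?_
    gcongr
    refine (norm_apply_e_le _ i).trans (le_of_eq ?_)
    exact LinearIsometryEquiv.norm_map ContinuousLinearMap.adjoint a
  have h2 := (hasSum_norm_sq (ofSummable _ (summable_row_mul b i x))).tsum_eq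
  simp only [ofSummable_apply] at h2
  rw [h2, ← mul_pow]
  gcongr

theorem sum_norm_schurFun_sq_le (a b : BEll2) (x : Ell2) (s : Finset ℕ) :
    ∑ i ∈ s, ‖schurFun a b x i‖ ^ 2 ≤ (‖a‖ * ‖b‖ * ‖x‖) ^ 2 := by
  have hcol : ∀ j, ∑ i ∈ s, ‖entry b i j‖ ^ 2 ≤ ‖b‖ ^ 2 := fun j => by
    refine (sum_le_hasSum s (fun i _ => by positivity) (hasSum_norm_sq (b (e j)))).trans ?_
    gcongr
    exact norm_apply_e_le b j
  calc ∑ i ∈ s, ‖schurFun a b x i‖ ^ 2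
      ≤ ∑ i ∈ s, ‖a‖ ^ 2 * ∑' j, ‖entry b i j * x j‖ ^ 2 :=
        Finset.sum_le_sum fun i _ => norm_schurFun_sq_le a b x i
    _ = ‖a‖ ^ 2 * ∑' j, ∑ i ∈ s, ‖entry b i j * x j‖ ^ 2 := by
        rw [← Finset.mul_sum, Summable.tsum_finsetSum fun i _ => summable_row_mul b i x]
    _ ≤ ‖a‖ ^ 2 * ∑' j, ‖b‖ ^ 2 * ‖x j‖ ^ 2 := by
        refine mul_le_mul_of_nonneg_left ?_ (by positivity)
        refine Summable.tsum_le_tsum (fun j => ?_)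
          (summable_sum fun i _ => summable_row_mul b i x)
          ((hasSum_norm_sq x).summable.mul_left _)
        simp only [norm_mul, mul_pow]
        rw [← Finset.sum_mul]
        exact mul_le_mul_of_nonneg_right (hcol j) (by positivity)
    _ = (‖a‖ * ‖b‖ * ‖x‖) ^ 2 := by
        rw [tsum_mul_left, (hasSum_norm_sq x).tsum_eq]
        ring

theorem summable_schurFun (a b : BEll2) (x : Ell2) :
    Summable fun i => ‖schurFun a b x i‖ ^ 2 :=
  summable_of_sum_le (fun i => by positivity) (sum_norm_schurFun_sq_le a b x)

/-- The Schur product `a ∗ b = [a_{ij} b_{ij}]` of `a, b ∈ B(ℓ²)`: the bounded operator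
sending `x` to `(∑_j a_{ij} b_{ij} x_j)_i`. -/
def schurMul (a b : BEll2) : BEll2 :=
  LinearMap.mkContinuous
    { toFun := fun x => ofSummable (schurFun a b x) (summable_schurFun a b x)
      map_add' := fun x y => by
        ext i
        change schurFun a b (x + y) i = schurFun a b x i + schurFun a b y i
        simp only [schurFun, lp.coeFn_add, Pi.add_apply, mul_add]
        exact (hasSum_schur a b x i).summable.tsum_add (hasSum_schur a b y i).summable
      map_smul' := fun c x => by
        ext i
        change schurFun a b (c • x) i = c * schurFun a b x i
        simp only [schurFun, lp.coeFn_smul, Pi.smul_apply, smul_eq_mul]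
        rw [← tsum_mul_left]
        exact tsum_congr fun j => by ring }
    (‖a‖ * ‖b‖)
    (fun x => by
      refine le_of_sq_le_sq ?_ (by positivity)
      refine le_of_eq_of_le (hasSum_norm_sq _).tsum_eq.symm ?_
      exact (summable_schurFun a b x).tsum_le_of_sum_le (sum_norm_schurFun_sq_le a b x))

/-- The matrix of `a ∗ b` is the entrywise product. -/
theorem entry_schurMul (a b : BEll2) (i j : ℕ) :
    entry (schurMul a b) i j = entry a i j * entry b i j := by
  change ∑' k, entry a i k * entry b i k * e j k = _
  rw [tsum_eq_single j]
  · simp [e]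
  · intro k hk
    simp [e, hk]

/-- The transpose `aᵗ` of `a ∈ B(ℓ²)`: conjugate the adjoint by the coordinatewise
complex conjugation of `ℓ²`. -/
def transpose (a : BEll2) : BEll2 :=
  ((starₗᵢ ℂ : Ell2 ≃ₗᵢ⋆[ℂ] Ell2) : Ell2 →L⋆[ℂ] Ell2).comp
    ((ContinuousLinearMap.adjoint a).comp
      ((starₗᵢ ℂ : Ell2 ≃ₗᵢ⋆[ℂ] Ell2) : Ell2 →L⋆[ℂ] Ell2))

/-- The matrix of `aᵗ` is `[a_{ji}]`. -/
theorem entry_transpose (a : BEll2) (i j : ℕ) : entry (transpose a) i j = entry a j i := by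
  have hs : star (e j) = e j := by
    ext k
    rw [lp.star_apply]
    by_cases h : k = j
    · subst h; simp [e]
    · simp [e, h]
  change (star (ContinuousLinearMap.adjoint a (star (e j)))) i = _
  rw [hs, lp.star_apply]
  exact conj_adjoint_apply_e a j i

/-- A bounded operator is determined by its matrix. -/
theorem ext_entry {a b : BEll2} (h : ∀ i j, entry a i j = entry b i j) : a = b := by
  refine ContinuousLinearMap.ext fun x => ?_
  have hx : HasSum (fun j => x j • e j) x := by
    have := lp.hasSum_single (p := 2) (by simp) x
    convert this using 2 with j
    rw [e, ← lp.single_smul]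
    simp
  have hab : ∀ j, a (e j) = b (e j) := fun j => lp.ext (funext fun i => h i j)
  refine (a.hasSum hx).unique ?_
  simpa only [map_smul, hab] using b.hasSum hx

/-- `u ∈ B(ℓ²)` is a permutation unitary: a unitary operator permuting the canonical basis. -/
def IsPermutationUnitary (u : BEll2) : Prop :=
  u ∈ unitary BEll2 ∧ ∃ π : Equiv.Perm ℕ, ∀ j, u (e j) = e (π j)

/-- `T` is contractive: its operator norm does not exceed one. -/
def IsContractive (T : BEll2 →ₗ[ℂ] BEll2) : Prop := ∀ a, ‖T a‖ ≤ ‖a‖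

/-- `T` is Schur multiplicative: `Ta ∗ Tb = T(a ∗ b)` for all `a, b`. -/
def IsSchurMultiplicative (T : BEll2 →ₗ[ℂ] BEll2) : Prop :=
  ∀ a b, schurMul (T a) (T b) = T (schurMul a b)

end BEll2

end

/-! Matrix units are exactly the minimal idempotents of the Schur product, so a Schur multiplicative
bijection permutes them; multiplying by a matrix unit isolates one entry, so `T` merely rearranges
entries along a permutation `ψ` of the grid (`IsSchurMultiplicative.exists_perm`). Contractivity
enters through one norm computation: the sum of two distinct matrix units has norm 1 when they share
neither row nor column, and larger norm otherwise. Hence `ψ` must preserve collinearity, and such a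
permutation is a product of a row and a column permutation, up to a swap
(`grid_equiv_eq_prod_or_swap`). The swap is the transpose. Conversely, permutation unitaries and
transposition rearrange entries without increasing the norm. -/

/-! ### Collinearity-preserving permutations of the grid -/

/-- A family of pairwise collinear points of a grid lies on one row or on one column. -/
theorem collinear_family_const {ι α β : Type*} (f : ι → α) (g : ι → β)
    (h : ∀ i j, f i = f j ∨ g i = g j) :
    (∀ i j, f i = f j) ∨ (∀ i j, g i = g j) := by
  by_contra! hcon
  obtain ⟨⟨i, j, hij⟩, k, l, hkl⟩ := hcon
  -- Points `k`, `l` share an `f`-value, which differs from `f i` or from `f j`; collinearity with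
  -- that point then forces `g k = g l`.
  have h1 := h i j
  have h2 := h k l
  have h3 := h i k
  have h4 := h i l
  have h5 := h j k
  have h6 := h j l
  grind

/-- If a bijection of the grid maps lines into lines and two rows into rows, then it is a product
of two permutations. -/
theorem grid_equiv_eq_prod_of_two_rows (f g : ℕ → ℕ → ℕ)
    (hinj : ∀ i j k l, f i j = f k l → g i j = g k l → i = k ∧ j = l)
    (hsurj : ∀ m n, ∃ i j, f i j = m ∧ g i j = n)
    (hrow : ∀ i, (∀ j l, f i j = f i l) ∨ (∀ j l, g i j = g i l))
    (hcol : ∀ j, (∀ i k, f i j = f k j) ∨ (∀ i k, g i j = g k j))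
    {r s : ℕ} (hrs : r ≠ s) (hr : ∀ j l, f r j = f r l) (hs : ∀ j l, f s j = f s l) :
    ∃ α β : Equiv.Perm ℕ, ∀ i j, f i j = α i ∧ g i j = β j := by
  -- If both rows landed in one row, injectivity would forbid constant `g` on any column, so the
  -- whole grid would land in that row.
  have hne : f r 0 ≠ f s 0 := by
    intro heq
    have hall : ∀ i j, f i j = f r 0 := by
      intro i j
      rcases hcol j with hf | hg
      · rw [hf i r, hr j 0]
      · refine absurd (hinj r j s j ?_ (hg r s)).1 hrs
        rw [hr j 0, hs j 0, heq]
    obtain ⟨i, j, hij, -⟩ := hsurj (f r 0 + 1) 0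
    have := hall i j
    omega
  have hg : ∀ j i k, g i j = g k j := by
    intro j
    refine (hcol j).resolve_left fun hf => hne ?_
    rw [hr 0 j, hs 0 j]
    exact hf r s
  have hf : ∀ i j l, f i j = f i l := by
    intro i
    -- As `g` depends only on the column, constancy on a single row would make it constant
    -- everywhere.
    refine (hrow i).resolve_right fun hgi => ?_
    obtain ⟨k, l, -, hkl⟩ := hsurj 0 (g i 0 + 1)
    have h1 := hg l k i
    have h2 := hgi l 0
    omega
  have hα : Function.Bijective fun i => f i 0 := by
    refine ⟨fun i k hik => (hinj i 0 k 0 hik (hg 0 i k)).1, fun m => ?_⟩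
    obtain ⟨i, j, hij, -⟩ := hsurj m 0
    exact ⟨i, (hf i 0 j).trans hij⟩
  have hβ : Function.Bijective fun j => g 0 j := by
    refine ⟨fun j l hjl => (hinj 0 j 0 l (hf 0 j l) hjl).2, fun n => ?_⟩
    obtain ⟨i, j, -, hij⟩ := hsurj 0 n
    exact ⟨j, (hg j 0 i).trans hij⟩
  exact ⟨Equiv.ofBijective _ hα, Equiv.ofBijective _ hβ, fun i j => ⟨hf i j 0, hg j i 0⟩⟩

/-- A permutation of the grid that maps collinear points to collinear points is a product of two
permutations, up to a swap of the coordinates. -/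
theorem grid_equiv_eq_prod_or_swap (ψ : Equiv.Perm (ℕ × ℕ))
    (h : ∀ p q : ℕ × ℕ, p.1 = q.1 ∨ p.2 = q.2 → (ψ p).1 = (ψ q).1 ∨ (ψ p).2 = (ψ q).2) :
    ∃ α β : Equiv.Perm ℕ, (∀ i j, ψ (i, j) = (α i, β j)) ∨ (∀ i j, ψ (i, j) = (β j, α i)) := by
  have hinj : ∀ i j k l, (ψ (i, j)).1 = (ψ (k, l)).1 → (ψ (i, j)).2 = (ψ (k, l)).2 →
      i = k ∧ j = l := fun i j k l h1 h2 => by simpa using ψ.injective (Prod.ext h1 h2)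
  have hsurj : ∀ m n, ∃ i j, (ψ (i, j)).1 = m ∧ (ψ (i, j)).2 = n := fun m n => by
    obtain ⟨⟨i, j⟩, hij⟩ := ψ.surjective (m, n)
    exact ⟨i, j, by rw [hij], by rw [hij]⟩
  have hrow : ∀ i, (∀ j l, (ψ (i, j)).1 = (ψ (i, l)).1) ∨ (∀ j l, (ψ (i, j)).2 = (ψ (i, l)).2) :=
    fun i => collinear_family_const _ _ fun j l => h (i, j) (i, l) (Or.inl rfl)
  have hcol : ∀ j, (∀ i k, (ψ (i, j)).1 = (ψ (k, j)).1) ∨ (∀ i k, (ψ (i, j)).2 = (ψ (k, j)).2) :=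
    fun j => collinear_family_const _ _ fun i k => h (i, j) (k, j) (Or.inr rfl)
  have hF : ∀ r s, r ≠ s → (∀ j l, (ψ (r, j)).1 = (ψ (r, l)).1) →
      (∀ j l, (ψ (s, j)).1 = (ψ (s, l)).1) →
      ∃ α β : Equiv.Perm ℕ, (∀ i j, ψ (i, j) = (α i, β j)) ∨ (∀ i j, ψ (i, j) = (β j, α i)) := by
    intro r s hrs hr hs
    obtain ⟨α, β, hαβ⟩ := grid_equiv_eq_prod_of_two_rows (fun i j => (ψ (i, j)).1)
      (fun i j => (ψ (i, j)).2) hinj hsurj hrow hcol hrs hr hs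
    exact ⟨α, β, Or.inl fun i j => Prod.ext (hαβ i j).1 (hαβ i j).2⟩
  have hG : ∀ r s, r ≠ s → (∀ j l, (ψ (r, j)).2 = (ψ (r, l)).2) →
      (∀ j l, (ψ (s, j)).2 = (ψ (s, l)).2) →
      ∃ α β : Equiv.Perm ℕ, (∀ i j, ψ (i, j) = (α i, β j)) ∨ (∀ i j, ψ (i, j) = (β j, α i)) := by
    intro r s hrs hr hs
    obtain ⟨α, β, hαβ⟩ := grid_equiv_eq_prod_of_two_rows (fun i j => (ψ (i, j)).2)
      (fun i j => (ψ (i, j)).1) (fun i j k l h1 h2 => hinj i j k l h2 h1)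
      (fun m n => (hsurj n m).imp fun i => Exists.imp fun j => And.symm)
      (fun i => (hrow i).symm) (fun j => (hcol j).symm) hrs hr hs
    exact ⟨α, β, Or.inr fun i j => Prod.ext (hαβ i j).2 (hαβ i j).1⟩
  -- Pigeonhole: among three rows, two are of the same type.
  rcases hrow 0 with h0 | h0 <;> rcases hrow 1 with h1 | h1
  · exact hF 0 1 (by decide) h0 h1
  · rcases hrow 2 with h2 | h2
    · exact hF 0 2 (by decide) h0 h2
    · exact hG 1 2 (by decide) h1 h2
  · rcases hrow 2 with h2 | h2
    · exact hF 1 2 (by decide) h1 h2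
    · exact hG 0 2 (by decide) h0 h2
  · exact hG 0 1 (by decide) h0 h1

/-! ### Matrix units and the Schur product -/

namespace Ell2

theorem e_apply (j i : ℕ) : e j i = if i = j then 1 else 0 := by
  by_cases h : i = j
  · subst h; simp [e]
  · simp [e, h]

theorem inner_e_e (i j : ℕ) : inner ℂ (e i) (e j) = if i = j then (1 : ℂ) else 0 := by
  rw [inner_e, e_apply]

theorem norm_add_e_sq {i j : ℕ} (h : i ≠ j) (c d : ℂ) :
    ‖c • e i + d • e j‖ ^ 2 = ‖c‖ ^ 2 + ‖d‖ ^ 2 := by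
  have := norm_add_sq_eq_norm_sq_add_norm_sq_of_inner_eq_zero (𝕜 := ℂ) (c • e i) (d • e j)
    (by simp [inner_smul_left, inner_smul_right, inner_e_e, h])
  simp only [norm_smul, norm_e, mul_one] at this
  simpa only [sq] using this

end Ell2

namespace BEll2

open Ell2

theorem entry_smul (c : ℂ) (a : BEll2) (i j : ℕ) : entry (c • a) i j = c * entry a i j := rfl

theorem entry_adjoint (a : BEll2) (i j : ℕ) :
    entry (ContinuousLinearMap.adjoint a) i j = conj (entry a j i) := by
  rw [← conj_adjoint_apply_e, ContinuousLinearMap.adjoint_adjoint]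
  rfl

/-- The matrix unit `e_{ij}`, the operator `x ↦ x_j e_i`. -/
noncomputable def matrixUnit (p : ℕ × ℕ) : BEll2 := (innerSL ℂ (e p.2)).smulRight (e p.1)

theorem matrixUnit_apply (p : ℕ × ℕ) (x : Ell2) : matrixUnit p x = x p.2 • e p.1 := by
  rw [← inner_e]
  rfl

theorem entry_matrixUnit (p : ℕ × ℕ) (i j : ℕ) :
    entry (matrixUnit p) i j = if p = (i, j) then 1 else 0 := by
  rw [entry, matrixUnit_apply, lp.coeFn_smul, Pi.smul_apply, e_apply, e_apply]
  by_cases h1 : i = p.1 <;> by_cases h2 : p.2 = j <;>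
    simp [h1, h2, Prod.ext_iff, eq_comm (a := p.1)]

theorem matrixUnit_ne_zero (p : ℕ × ℕ) : matrixUnit p ≠ 0 := fun h => by
  have := entry_matrixUnit p p.1 p.2
  rw [h] at this
  simp [entry] at this

theorem matrixUnit_injective : Function.Injective matrixUnit := fun p q h => by
  have := entry_matrixUnit p q.1 q.2
  rw [h, entry_matrixUnit] at this
  by_contra hne
  simp [hne] at this

theorem schurMul_matrixUnit (a : BEll2) (p : ℕ × ℕ) :
    schurMul a (matrixUnit p) = entry a p.1 p.2 • matrixUnit p := by
  refine ext_entry fun i j => ?_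
  rw [entry_schurMul, entry_smul, entry_matrixUnit]
  by_cases h : p = (i, j)
  · subst h; rfl
  · simp [h]

theorem schurMul_comm (a b : BEll2) : schurMul a b = schurMul b a :=
  ext_entry fun i j => by rw [entry_schurMul, entry_schurMul, mul_comm]

/-- A nonzero Schur idempotent `a` such that `a ∗ b` is always a multiple of `a` is a matrix
unit. -/
theorem exists_eq_matrixUnit {a : BEll2} (h0 : a ≠ 0) (hidem : schurMul a a = a)
    (hmin : ∀ b, ∃ c : ℂ, schurMul a b = c • a) : ∃ p, a = matrixUnit p := by
  obtain ⟨i, j, hij⟩ : ∃ i j, entry a i j ≠ 0 := by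
    by_contra! hcon
    exact h0 (ext_entry fun i j => by rw [hcon i j]; rfl)
  have hone : entry a i j = 1 := by
    have := entry_schurMul a a i j
    rw [hidem] at this
    exact mul_left_cancel₀ hij (by rw [mul_one, ← this])
  -- Testing minimality at a nonzero entry makes the matrix unit there a multiple of `a`.
  obtain ⟨c, hc⟩ := hmin (matrixUnit (i, j))
  rw [schurMul_matrixUnit, hone, one_smul] at hc
  have h1 : c = 1 := by
    have := entry_matrixUnit (i, j) i j
    rw [hc, entry_smul, hone, mul_one, if_pos rfl] at this
    exact this
  exact ⟨(i, j), by rw [hc, h1, one_smul]⟩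

/-- A Schur multiplicative linear bijection maps matrix units to matrix units. -/
theorem IsSchurMultiplicative.exists_apply_matrixUnit {T : BEll2 →ₗ[ℂ] BEll2}
    (hT : Function.Bijective T) (h : IsSchurMultiplicative T) (p : ℕ × ℕ) :
    ∃ q, T (matrixUnit p) = matrixUnit q := by
  refine exists_eq_matrixUnit ?_ ?_ ?_
  · rw [← map_zero T]
    exact hT.1.ne (matrixUnit_ne_zero p)
  · rw [h, schurMul_matrixUnit, entry_matrixUnit, if_pos rfl, one_smul]
  · intro b
    obtain ⟨b, rfl⟩ := hT.2 b
    exact ⟨entry b p.1 p.2, by rw [h, schurMul_comm, schurMul_matrixUnit, map_smul]⟩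

/-- A Schur multiplicative linear bijection permutes the matrix entries. -/
theorem IsSchurMultiplicative.exists_perm {T : BEll2 →ₗ[ℂ] BEll2}
    (hT : Function.Bijective T) (h : IsSchurMultiplicative T) :
    ∃ ψ : Equiv.Perm (ℕ × ℕ), (∀ p, T (matrixUnit (ψ p)) = matrixUnit p) ∧
      ∀ a i j, entry (T a) i j = entry a (ψ (i, j)).1 (ψ (i, j)).2 := by
  let S := (LinearEquiv.ofBijective T hT).symm
  have hTS : ∀ a, T (S a) = a := (LinearEquiv.ofBijective T hT).apply_symm_apply
  have hS : IsSchurMultiplicative (S : BEll2 →ₗ[ℂ] BEll2) := fun a b => hT.1 <| by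
    change T (schurMul (S a) (S b)) = T (S (schurMul a b))
    rw [← h, hTS, hTS, hTS]
  choose φ hφ using h.exists_apply_matrixUnit hT
  choose ψ hψ using hS.exists_apply_matrixUnit S.bijective
  have hψ' : ∀ p, T (matrixUnit (ψ p)) = matrixUnit p := fun p => by
    rw [← hψ p]
    exact hTS _
  refine ⟨⟨ψ, φ, fun p => matrixUnit_injective ?_, fun p => matrixUnit_injective ?_⟩, hψ',
    fun a i j => ?_⟩
  · rw [← hφ, hψ']
  · exact hT.1 (by rw [hψ', hφ])
  -- The entry is isolated algebraically, which avoids any continuity of `T`: the span of the matrix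
  -- units is not norm dense.
  · have h1 := h a (matrixUnit (ψ (i, j)))
    rw [hψ', schurMul_matrixUnit, schurMul_matrixUnit, map_smul, hψ'] at h1
    have h2 := congrArg (fun b => entry b i j) h1
    simp only [entry_smul, entry_matrixUnit, if_true, mul_one] at h2
    exact h2

/-! ### Norms of sums of two matrix units -/

/-- The sum of two matrix units in different rows and columns is a contraction. -/
theorem norm_matrixUnit_add_le_one {p q : ℕ × ℕ} (h1 : p.1 ≠ q.1) (h2 : p.2 ≠ q.2) :
    ‖matrixUnit p + matrixUnit q‖ ≤ 1 := by
  refine ContinuousLinearMap.opNorm_le_bound _ zero_le_one fun x => ?_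
  rw [one_mul, add_apply, matrixUnit_apply, matrixUnit_apply]
  refine le_of_sq_le_sq ?_ (norm_nonneg x)
  rw [norm_add_e_sq h1]
  have := sum_le_hasSum {p.2, q.2} (fun i _ => by positivity) (hasSum_norm_sq x)
  rwa [Finset.sum_pair h2] at this

/-- The sum of two different matrix units in the same row or column is not a contraction. -/
theorem one_lt_norm_matrixUnit_add {p q : ℕ × ℕ} (hpq : p ≠ q) (h : p.1 = q.1 ∨ p.2 = q.2) :
    1 < ‖matrixUnit p + matrixUnit q‖ := by
  by_contra! hle
  obtain ⟨i, j⟩ := p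
  obtain ⟨k, l⟩ := q
  dsimp only at h
  by_cases hjl : j = l
  · subst hjl
    have hik : i ≠ k := fun hik => hpq (by rw [hik])
    -- Same column: the unit vector `e j` is sent to a vector of norm √2.
    have h1 := (norm_apply_e_le (matrixUnit (i, j) + matrixUnit (k, j)) j).trans hle
    have h2 := norm_add_e_sq hik 1 1
    rw [add_apply, matrixUnit_apply, matrixUnit_apply] at h1
    simp only [e_apply, if_true] at h1
    rw [norm_one] at h2
    nlinarith [norm_nonneg ((1 : ℂ) • e i + (1 : ℂ) • e k)]
  · obtain rfl : i = k := h.resolve_right hjl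
    -- Same row: `e j + e l`, of norm √2, is sent to a vector of norm 2.
    have h1 := (matrixUnit (i, j) + matrixUnit (i, l)).le_of_opNorm_le hle
      ((1 : ℂ) • e j + (1 : ℂ) • e l)
    have h2 := norm_add_e_sq hjl 1 1
    have h3 : (matrixUnit (i, j) + matrixUnit (i, l)) ((1 : ℂ) • e j + (1 : ℂ) • e l) =
        (2 : ℂ) • e i := by
      simp only [add_apply, matrixUnit_apply, lp.coeFn_add, one_smul,
        Pi.add_apply, e_apply, if_true, if_neg hjl, if_neg (Ne.symm hjl), ← add_smul]
      norm_num
    rw [h3, norm_smul, norm_e, one_mul, mul_one] at h1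
    rw [norm_one] at h2
    rw [Complex.norm_two] at h1
    nlinarith

/-! ### Permutation operators and the transpose -/

/-- The permutation operator `x ↦ (x_{σ i})_i`. -/
noncomputable def permOp (σ : Equiv.Perm ℕ) : BEll2 :=
  LinearMap.mkContinuous
    { toFun := fun x => ofSummable (fun i => x (σ i))
        (((Equiv.summable_iff σ).2 (hasSum_norm_sq x).summable :))
      map_add' := fun _ _ => rfl
      map_smul' := fun _ _ => rfl }
    1
    (fun x => by
      rw [one_mul]
      refine le_of_sq_le_sq (le_of_eq ?_) (norm_nonneg x)
      exact (hasSum_norm_sq _).unique ((Equiv.hasSum_iff σ).2 (hasSum_norm_sq x)))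

theorem permOp_apply (σ : Equiv.Perm ℕ) (x : Ell2) (i : ℕ) : permOp σ x i = x (σ i) := rfl

theorem permOp_e (σ : Equiv.Perm ℕ) (j : ℕ) : permOp σ (e j) = e (σ.symm j) := by
  ext i
  rw [permOp_apply, e_apply, e_apply]
  simp only [Equiv.eq_symm_apply]

theorem adjoint_permOp (σ : Equiv.Perm ℕ) :
    ContinuousLinearMap.adjoint (permOp σ) = permOp σ.symm := by
  refine ext_entry fun i j => ?_
  rw [entry_adjoint, entry, entry, permOp_apply, permOp_apply, e_apply, e_apply]
  simp only [Equiv.symm_apply_eq, eq_comm (a := i)]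
  by_cases h : σ j = i <;> simp [h]

theorem isPermutationUnitary_permOp (σ : Equiv.Perm ℕ) : IsPermutationUnitary (permOp σ) := by
  refine ⟨Unitary.mem_iff.2 ⟨?_, ?_⟩, σ.symm, permOp_e σ⟩ <;>
  · rw [ContinuousLinearMap.star_eq_adjoint, adjoint_permOp]
    ext x i
    simp [permOp_apply]

/-- The right factor acts first, on `e j`, whence the inverse; a column map `β` requires `permOp
β.symm` on the right. -/
theorem entry_permOp_mul_mul_permOp (σ τ : Equiv.Perm ℕ) (a : BEll2) (i j : ℕ) :
    entry (permOp σ * a * permOp τ) i j = entry a (σ i) (τ.symm j) := by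
  rw [entry, mul_apply_eq_comp, mul_apply_eq_comp, permOp_apply, permOp_e]
  rfl

/-- A permutation unitary is the permutation operator of its permutation. -/
theorem IsPermutationUnitary.exists_eq_permOp {u : BEll2} (hu : IsPermutationUnitary u) :
    ∃ σ, u = permOp σ := by
  obtain ⟨-, π, hπ⟩ := hu
  refine ⟨π.symm, ext_entry fun i j => ?_⟩
  rw [entry, entry, hπ, permOp_e, Equiv.symm_symm]

theorem norm_mul_mul_of_isPermutationUnitary {u v : BEll2} (hu : IsPermutationUnitary u)
    (hv : IsPermutationUnitary v) (a : BEll2) : ‖u * a * v‖ = ‖a‖ := by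
  rw [CStarRing.norm_mul_mem_unitary _ hv.1, CStarRing.norm_mem_unitary_mul _ hu.1]

theorem norm_transpose_le (a : BEll2) : ‖transpose a‖ ≤ ‖a‖ := by
  refine ContinuousLinearMap.opNorm_le_bound _ (norm_nonneg a) fun x => ?_
  change ‖star (ContinuousLinearMap.adjoint a (star x))‖ ≤ _
  rw [norm_star, ← norm_star x, ← LinearIsometryEquiv.norm_map ContinuousLinearMap.adjoint a]
  exact ContinuousLinearMap.le_opNorm _ _

/-- A map permuting the matrix entries is Schur multiplicative. -/
theorem isSchurMultiplicative_of_entry {T : BEll2 →ₗ[ℂ] BEll2} (r s : ℕ → ℕ → ℕ)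
    (h : ∀ a i j, entry (T a) i j = entry a (r i j) (s i j)) : IsSchurMultiplicative T :=
  fun a b => ext_entry fun i j => by simp only [entry_schurMul, h]

end BEll2

open BEll2 in
theorem theorem2p5 (T : BEll2 →ₗ[ℂ] BEll2) (hT : Function.Bijective T) :
    (BEll2.IsContractive T ∧ BEll2.IsSchurMultiplicative T) ↔
      ∃ u v : BEll2, BEll2.IsPermutationUnitary u ∧ BEll2.IsPermutationUnitary v ∧
        ((∀ a : BEll2, T a = u * a * v) ∨
          (∀ a : BEll2, T a = u * BEll2.transpose a * v)) := by
  constructor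
  · rintro ⟨hc, hm⟩
    obtain ⟨ψ, hψ, hentry⟩ := hm.exists_perm hT
    have hcol : ∀ p q : ℕ × ℕ, p.1 = q.1 ∨ p.2 = q.2 →
        (ψ p).1 = (ψ q).1 ∨ (ψ p).2 = (ψ q).2 := by
      intro p q hpq
      by_contra! hne
      -- Otherwise `T` would send a sum of norm at most 1 to one of norm above 1.
      have h1 := hc (matrixUnit (ψ p) + matrixUnit (ψ q))
      rw [map_add, hψ, hψ] at h1
      have h2 := norm_matrixUnit_add_le_one hne.1 hne.2
      have h3 := one_lt_norm_matrixUnit_add (fun h : p = q => hne.1 (by rw [h])) hpq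
      linarith
    obtain ⟨α, β, h | h⟩ := grid_equiv_eq_prod_or_swap ψ hcol
    · refine ⟨permOp α, permOp β.symm, isPermutationUnitary_permOp _,
        isPermutationUnitary_permOp _, Or.inl fun a => ext_entry fun i j => ?_⟩
      rw [hentry, entry_permOp_mul_mul_permOp, h, Equiv.symm_symm]
    · refine ⟨permOp α, permOp β.symm, isPermutationUnitary_permOp _,
        isPermutationUnitary_permOp _, Or.inr fun a => ext_entry fun i j => ?_⟩
      rw [hentry, entry_permOp_mul_mul_permOp, entry_transpose, h, Equiv.symm_symm]
  · rintro ⟨u, v, hu, hv, h | h⟩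
    · refine ⟨fun a => by rw [h, norm_mul_mul_of_isPermutationUnitary hu hv], ?_⟩
      obtain ⟨σ, rfl⟩ := hu.exists_eq_permOp
      obtain ⟨τ, rfl⟩ := hv.exists_eq_permOp
      exact isSchurMultiplicative_of_entry (fun i _ => σ i) (fun _ j => τ.symm j) fun a i j => by
        rw [h, entry_permOp_mul_mul_permOp]
    · refine ⟨fun a => ?_, ?_⟩
      · rw [h, norm_mul_mul_of_isPermutationUnitary hu hv]
        exact norm_transpose_le a
      obtain ⟨σ, rfl⟩ := hu.exists_eq_permOp
      obtain ⟨τ, rfl⟩ := hv.exists_eq_permOp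
      exact isSchurMultiplicative_of_entry (fun _ j => τ.symm j) (fun i _ => σ i) fun a i j => by
        rw [h, entry_permOp_mul_mul_permOp, entry_transpose]
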